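/- Let $1\le a<b$ be integers. Logarithms are to base $2$, strings are binary, and an edit is the insertion or deletion of one symbol (the result holds likewise when substitutions of one symbol also count as edits). A syndrome is a function $\Phi$ that, for every $n$, maps $\{0,1\}^n$ to bit strings. It corrects $a$ edits if $\Phi(x)\ne\Phi(x')$ whenever $x\ne x'$ have the same length and some string $y$ can be obtained from each of them by at most $a$ edits. There are $\rho:\mathbb N\to\mathbb N$ and a constant $C$, depending only on $a$, $b$ (and the choice of edits), with $$\rho(n)\le(4b-2a)\log n+C\log\log n\qquad(n\ge 3),$$ such that for every syndrome $\Phi_a$ that corrects $a$ edits there are functions $\Phi_{b|a}:\{0,1\}^n\to\{0,1\}^{\rho(n)}$ ($n\ge0$) and a decoder $\mathrm{dec}$ with the following property: for all $n$, all $x\in\{0,1\}^n$ and every $y$ obtained from $x$ by at most $b$ edits, $$\mathrm{dec}\bigl(n,\,y,\,\Phi_a(x),\,\Phi_{b|a}(x)\bigr)=x .$$ Moreover, if $\Phi_a(x)$ can be computed in time polynomial in $n=|x|$, then $\Phi_{b|a}(x)$ can be computed in time polynomial in $n$, and $\mathrm{dec}$ runs in time polynomial in $n$ on the above data. -/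

import Mathlib

/-! Binary strings and edits. A string of length `n` over `{0, 1}` is an `x : List Bool` with
`x.length = n`. -/

/-- The two usual meanings of "edit": insertions and deletions only, or insertions, deletions and
substitutions. -/
inductive EditModel : Type
  | insDel
  | insDelSub

/-- A single edit of one symbol. -/
inductive EditStep : EditModel → List Bool → List Bool → Prop
  | insertion (m : EditModel) (u v : List Bool) (c : Bool) :
      EditStep m (u ++ v) (u ++ c :: v)
  | deletion (m : EditModel) (u v : List Bool) (c : Bool) :
      EditStep m (u ++ c :: v) (u ++ v)
  | substitution (u v : List Bool) (c d : Bool) :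
      EditStep .insDelSub (u ++ c :: v) (u ++ d :: v)

/-- `EditsWithin m k x y`: the string `y` is obtained from `x` by at most `k` edits, that is,
the edit distance of `x` and `y` is at most `k`. -/
inductive EditsWithin (m : EditModel) : ℕ → List Bool → List Bool → Prop
  | refl (k : ℕ) (x : List Bool) : EditsWithin m k x x
  | step {k : ℕ} {x y z : List Bool} :
      EditStep m x y → EditsWithin m k y z → EditsWithin m (k + 1) x z

/-- The syndrome `Φ` (for every `n` a function on the strings of length `n`, with bit strings as
values) corrects `a` edits: two distinct inputs of the same length that can produce the same
output `y` by at most `a` edits have distinct syndromes. -/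
def CorrectsEdits (m : EditModel) (a : ℕ) (Φ : List Bool → List Bool) : Prop :=
  ∀ x x' y : List Bool, x.length = x'.length → x ≠ x' →
    EditsWithin m a x y → EditsWithin m a x' y → Φ x ≠ Φ x'

/-! A machine model with a step count: while programs on binary trees. A program transforms one
value. Values are passed by reference, so `cons` allocates one cell and `head` and `tail` follow
one pointer. Every elementary operation, test and passage from one command to the next costs
one step. -/

/-- The data: binary trees without labels. -/
inductive Val : Type
  | nil : Val
  | cons : Val → Val → Val

/-- While programs; the value `nil` stands for "false" and every other value for "true". -/
inductive Prog : Type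
  | skip : Prog
  | nil : Prog
  | head : Prog
  | tail : Prog
  | cons : Prog → Prog → Prog
  | seq : Prog → Prog → Prog
  | ite : Prog → Prog → Prog → Prog
  | loop : Prog → Prog → Prog

/-- `Run P v w t`: the program `P`, started on the value `v`, halts with the value `w` after
exactly `t` steps. -/
inductive Run : Prog → Val → Val → ℕ → Prop
  | skip (v : Val) : Run .skip v v 1
  | nil (v : Val) : Run .nil v .nil 1
  | head (h t : Val) : Run .head (.cons h t) h 1
  | head_nil : Run .head .nil .nil 1
  | tail (h t : Val) : Run .tail (.cons h t) t 1
  | tail_nil : Run .tail .nil .nil 1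
  | cons {P Q : Prog} {v u w : Val} {i j : ℕ} :
      Run P v u i → Run Q v w j → Run (.cons P Q) v (.cons u w) (i + j + 1)
  | seq {P Q : Prog} {v u w : Val} {i j : ℕ} :
      Run P v u i → Run Q u w j → Run (.seq P Q) v w (i + j + 1)
  | ite_true {T P Q : Prog} {v h t w : Val} {i j : ℕ} :
      Run T v (.cons h t) i → Run P v w j → Run (.ite T P Q) v w (i + j + 1)
  | ite_false {T P Q : Prog} {v w : Val} {i j : ℕ} :
      Run T v .nil i → Run Q v w j → Run (.ite T P Q) v w (i + j + 1)
  | loop_exit {T P : Prog} {v : Val} {i : ℕ} :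
      Run T v .nil i → Run (.loop T P) v v (i + 1)
  | loop_next {T P : Prog} {v h t u w : Val} {i j k : ℕ} :
      Run T v (.cons h t) i → Run P v u j → Run (.loop T P) u w k →
        Run (.loop T P) v w (i + j + k + 1)

/-- The code of a bit. -/
def encodeBit : Bool → Val
  | false => .nil
  | true => .cons .nil .nil

/-- The code of a bit string, as a linked list. -/
def encodeString : List Bool → Val
  | [] => .nil
  | c :: x => .cons (encodeBit c) (encodeString x)

/-- The unary code of a natural number. -/
def encodeNat : ℕ → Val
  | 0 => .nil
  | n + 1 => .cons .nil (encodeNat n)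

/-- The code of the data available to a decoder: the block length `n`, the received string `y`
and two syndromes `s` and `t`. -/
def encodeReceived (n : ℕ) (y s t : List Bool) : Val :=
  .cons (encodeNat n) (.cons (encodeString y) (.cons (encodeString s) (encodeString t)))

/-- The function `f` on strings is individually computable in time polynomial in the length of
its argument. -/
def ComputableInPolyTime (f : List Bool → List Bool) : Prop :=
  ∃ (P : Prog) (p : Polynomial ℕ), ∀ x : List Bool,
    ∃ t : ℕ, t ≤ p.eval x.length ∧ Run P (encodeString x) (encodeString (f x)) t

/-- `dec` recovers every string `x`, of any length `n`, from `n`, the syndromes `Φ x` and `Ψ x`,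
and any `y` that is obtained from `x` by at most `b` edits. -/
def Recovers (m : EditModel) (b : ℕ) (Φ Ψ : List Bool → List Bool)
    (dec : ℕ → List Bool → List Bool → List Bool → List Bool) : Prop :=
  ∀ x y : List Bool, EditsWithin m b x y → dec x.length y (Φ x) (Ψ x) = x

/-- The decoder `dec` runs in time polynomial in the block length, on all data that it can
receive. -/
def DecodesInPolyTime (m : EditModel) (b : ℕ) (Φ Ψ : List Bool → List Bool)
    (dec : ℕ → List Bool → List Bool → List Bool → List Bool) : Prop :=
  ∃ (P : Prog) (p : Polynomial ℕ), ∀ x y : List Bool, EditsWithin m b x y →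
    ∃ t : ℕ, t ≤ p.eval x.length ∧
      Run P (encodeReceived x.length y (Φ x) (Ψ x))
        (encodeString (dec x.length y (Φ x) (Ψ x))) t

/-! Two inputs that reach a common `y` by at most `b` edits are within `2b` edits of each other, so
`x` need only be separated from the strings `confusable` with it that share its syndrome `Φ`. There
are only O(n^(2b-a)) of these (`CorrectsEdits.card_le`): cut an edit path of length `2b` at a point
`z` within `2b-a` edits of `x`; since `Φ` corrects `a` edits, at most one string of the same length
and syndrome lies within `a` edits of each `z`.

Separation is by residues. Given `N` nonzero differences of at most `R` bits, some modulus up to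
2(RN+1) divides none of them (`exists_not_dvd`). Applied directly to binary values, this has `R = n`
and wastes a factor `n` in the modulus. So residues are used twice. The first round separates `x`
from everything confusable with it, ignoring `Φ`, and yields a `digest` of O(log n) bits. The second
round separates digests within one syndrome class, with modulus O(n^(2b-a) log n). Storing the
modulus and the residue costs twice (2b-a) log n + log log n + O(1) bits; the O(1) is absorbed by
log log n.

Since `a` and `b` are fixed, edit balls have polynomial size, so the moduli are found by exhaustive
search and the decoder scans the ball around `y`. The running times come from the calculus of
`PolyTime` functions, in which numbers are unary. -/

/-! ### Tree codes and their sizes. -/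

/-- The number of nodes of a tree. -/
def Val.size : Val → ℕ
  | .nil => 1
  | .cons u v => u.size + v.size + 1

/-- The height of a tree. -/
def Val.height : Val → ℕ
  | .nil => 0
  | .cons u v => max u.height v.height + 1

/-- Types whose elements are represented by trees. -/
class Enc (α : Type) where
  enc : α → Val

open Enc (enc)

instance : Enc Unit := ⟨fun _ => .nil⟩

instance : Enc Bool := ⟨encodeBit⟩

instance : Enc ℕ := ⟨encodeNat⟩

instance {α β : Type} [Enc α] [Enc β] : Enc (α × β) := ⟨fun p => .cons (enc p.1) (enc p.2)⟩

/-- The code of a list, as a linked list. -/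
def encodeList {α : Type} [Enc α] : List α → Val
  | [] => .nil
  | a :: l => .cons (enc a) (encodeList l)

instance {α : Type} [Enc α] : Enc (List α) := ⟨encodeList⟩

/-- The size of the code of an element. -/
def sz {α : Type} [Enc α] (a : α) : ℕ := (enc a).size

section size

variable {α β : Type} [Enc α] [Enc β]

theorem Val.size_pos (v : Val) : 0 < v.size := by cases v <;> simp [Val.size]

theorem sz_pos (a : α) : 0 < sz a := Val.size_pos _

@[simp] theorem enc_pair (a : α) (b : β) : enc (a, b) = .cons (enc a) (enc b) := rfl

@[simp] theorem enc_nil : enc ([] : List α) = .nil := rfl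

@[simp] theorem enc_cons (a : α) (l : List α) : enc (a :: l) = .cons (enc a) (enc l) := rfl

@[simp] theorem sz_pair (a : α) (b : β) : sz (a, b) = sz a + sz b + 1 := rfl

@[simp] theorem sz_nil : sz ([] : List α) = 1 := rfl

@[simp] theorem sz_cons (a : α) (l : List α) : sz (a :: l) = sz a + sz l + 1 := rfl

@[simp] theorem sz_unit (u : Unit) : sz u = 1 := rfl

@[simp] theorem sz_nat (n : ℕ) : sz n = 2 * n + 1 := by
  induction n with
  | zero => rfl
  | succ n ih =>
    have : sz (n + 1) = 1 + sz n + 1 := rfl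
    omega

theorem sz_bool_le (c : Bool) : sz c ≤ 3 := by cases c <;> decide

@[simp] theorem sz_append (l l' : List α) : sz (l ++ l') + 1 = sz l + sz l' := by
  induction l with
  | nil => simp [add_comm]
  | cons a l ih => simp; omega

theorem length_lt_sz (l : List α) : l.length < sz l := by
  induction l with
  | nil => simp
  | cons a l ih => simp; have := sz_pos a; omega

theorem sz_le_of_mem {a : α} {l : List α} (h : a ∈ l) : sz a ≤ sz l := by
  induction l with
  | nil => simp at h
  | cons b l ih =>
    rcases List.mem_cons.1 h with rfl | h
    · simp; omega
    · have := ih h; simp; omega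

theorem enc_string (x : List Bool) : enc x = encodeString x := by
  induction x with
  | nil => rfl
  | cons c x ih => rw [enc_cons, ih]; rfl

theorem sz_string_le (x : List Bool) : sz x ≤ 4 * x.length + 1 := by
  induction x with
  | nil => simp
  | cons c x ih => simp; have := sz_bool_le c; omega

theorem enc_replicate (n : ℕ) : enc (List.replicate n ()) = enc n := by
  induction n with
  | zero => rfl
  | succ n ih => rw [List.replicate_succ, enc_cons, ih]; rfl

end size

/-! ### Closure properties of polynomial-time functions. -/

theorem Polynomial.eval_mono_nat (p : Polynomial ℕ) {m n : ℕ} (h : m ≤ n) :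
    p.eval m ≤ p.eval n := by
  simp only [Polynomial.eval_eq_sum, Polynomial.sum]
  gcongr

/-- The function `f` is computable by a while program in time polynomial in the size of its
argument, and its values have polynomial size. -/
@[fun_prop]
def PolyTime {α β : Type} [Enc α] [Enc β] (f : α → β) : Prop :=
  ∃ (P : Prog) (p : Polynomial ℕ), ∀ a : α, sz (f a) ≤ p.eval (sz a) ∧
    ∃ t : ℕ, t ≤ p.eval (sz a) ∧ Run P (enc a) (enc (f a)) t

namespace PolyTime

variable {α β γ : Type} [Enc α] [Enc β] [Enc γ]

theorem of_bounds {f : α → β} (P : Prog) (p q : Polynomial ℕ)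
    (hp : ∀ a, sz (f a) ≤ p.eval (sz a))
    (hq : ∀ a, ∃ t : ℕ, t ≤ q.eval (sz a) ∧ Run P (enc a) (enc (f a)) t) : PolyTime f := by
  refine ⟨P, p + q, fun a => ⟨?_, ?_⟩⟩
  · have := hp a
    simp only [Polynomial.eval_add]; omega
  · obtain ⟨t, ht, hr⟩ := hq a
    exact ⟨t, by simp only [Polynomial.eval_add]; omega, hr⟩

theorem size_le {f : α → β} (hf : PolyTime f) :
    ∃ p : Polynomial ℕ, ∀ a, sz (f a) ≤ p.eval (sz a) := by
  obtain ⟨_, p, h⟩ := hf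
  exact ⟨p, fun a => (h a).1⟩

@[fun_prop] theorem id' : PolyTime (fun a : α => a) :=
  of_bounds .skip .X 1 (by simp) fun a => ⟨1, by simp, .skip _⟩

theorem exists_const (w : Val) : ∃ (P : Prog) (t : ℕ), ∀ v, Run P v w t := by
  induction w with
  | nil => exact ⟨.nil, 1, fun v => .nil v⟩
  | cons u w hu hw =>
    obtain ⟨P, s, hP⟩ := hu
    obtain ⟨Q, t, hQ⟩ := hw
    exact ⟨.cons P Q, _, fun v => .cons (hP v) (hQ v)⟩

@[fun_prop] theorem const (b : β) : PolyTime (fun _ : α => b) := by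
  obtain ⟨P, t, hP⟩ := exists_const (enc b)
  exact of_bounds P (.C (sz b)) (.C t) (by simp) fun a => ⟨t, by simp, hP _⟩

-- The size bound inside `PolyTime` is needed here: because cells are shared, repeated `cons` can
-- double the size of a tree in constant time, so running time alone does not bound the size of the
-- intermediate value polynomially.
@[fun_prop] theorem comp {g : β → γ} {f : α → β} (hg : PolyTime g) (hf : PolyTime f) :
    PolyTime (fun a => g (f a)) := by
  obtain ⟨P, p, hP⟩ := hf
  obtain ⟨Q, q, hQ⟩ := hg
  have key a : q.eval (sz (f a)) ≤ (q.comp p).eval (sz a) := by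
    rw [Polynomial.eval_comp]
    exact q.eval_mono_nat (hP a).1
  refine of_bounds (.seq P Q) (q.comp p) (p + q.comp p + 1)
    (fun a => (hQ _).1.trans (key a)) fun a => ?_
  obtain ⟨s, hs, hs'⟩ := (hP a).2
  obtain ⟨t, ht, ht'⟩ := (hQ (f a)).2
  refine ⟨_, ?_, .seq hs' ht'⟩
  have := key a
  simp only [Polynomial.eval_add, Polynomial.eval_one]
  omega

@[fun_prop] theorem prodMk {f : α → β} {g : α → γ} (hf : PolyTime f) (hg : PolyTime g) :
    PolyTime (fun a => (f a, g a)) := by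
  obtain ⟨P, p, hP⟩ := hf
  obtain ⟨Q, q, hQ⟩ := hg
  refine ⟨.cons P Q, p + q + 1, fun a => ⟨?_, ?_⟩⟩
  · have h₁ := (hP a).1
    have h₂ := (hQ a).1
    simp only [Polynomial.eval_add, Polynomial.eval_one, sz_pair]
    omega
  · obtain ⟨s, hs, hs'⟩ := (hP a).2
    obtain ⟨t, ht, ht'⟩ := (hQ a).2
    refine ⟨_, ?_, .cons hs' ht'⟩
    simp only [Polynomial.eval_add, Polynomial.eval_one]
    omega

@[fun_prop] theorem fst : PolyTime (fun p : α × β => p.1) :=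
  of_bounds .head .X 1 (fun p => by simp [show sz p = sz p.1 + sz p.2 + 1 from rfl]; omega)
    fun p => ⟨1, by simp, .head _ _⟩

@[fun_prop] theorem snd : PolyTime (fun p : α × β => p.2) :=
  of_bounds .tail .X 1 (fun p => by simp [show sz p = sz p.1 + sz p.2 + 1 from rfl]; omega)
    fun p => ⟨1, by simp, .tail _ _⟩

/-- A change of representation costs nothing if the codes agree. -/
theorem of_enc_eq {f : α → β} (h : ∀ a, enc (f a) = enc a) : PolyTime f :=
  of_bounds .skip .X 1 (fun a => by simp [sz, h]) fun a => ⟨1, by simp, by rw [h]; exact .skip _⟩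

@[fun_prop] theorem cons {f : α → β} {g : α → List β} (hf : PolyTime f) (hg : PolyTime g) :
    PolyTime (fun a => f a :: g a) := by
  have : PolyTime (fun p : β × List β => p.1 :: p.2) := of_enc_eq fun _ => rfl
  exact this.comp (hf.prodMk hg)

@[fun_prop] theorem succ {f : α → ℕ} (hf : PolyTime f) : PolyTime (fun a => f a + 1) := by
  have : PolyTime (fun p : Unit × ℕ => p.2 + 1) := of_enc_eq fun _ => rfl
  exact this.comp ((const ()).prodMk hf)

@[fun_prop] theorem tail {f : α → List β} (hf : PolyTime f) : PolyTime (fun a => (f a).tail) := by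
  have : PolyTime (fun l : List β => l.tail) := by
    refine of_bounds .tail .X 1 (fun l => ?_) fun l => ⟨1, by simp, ?_⟩
    · cases l <;> simp; omega
    · cases l
      · exact .tail_nil
      · exact .tail _ _
  exact this.comp hf

@[fun_prop] theorem pred {f : α → ℕ} (hf : PolyTime f) : PolyTime (fun a => (f a).pred) := by
  have : PolyTime (fun n : ℕ => n.pred) := by
    refine of_bounds .tail .X 1 (fun n => ?_) fun n => ⟨1, by simp, ?_⟩
    · cases n <;> simp
    · cases n
      · exact .tail_nil
      · exact .tail _ _
  exact this.comp hf

@[fun_prop] theorem headD {f : α → List β} {g : α → β} (hf : PolyTime f) (hg : PolyTime g) :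
    PolyTime (fun a => (f a).headD (g a)) := by
  have : PolyTime (fun p : List β × β => p.1.headD p.2) := by
    refine of_bounds (.ite .head (.seq .head .head) .tail) .X 5 (fun p => ?_) fun p => ?_
    · rcases p with ⟨_ | ⟨a, l⟩, b⟩ <;> simp <;> omega
    · rcases p with ⟨_ | ⟨a, l⟩, b⟩
      · exact ⟨3, by simp, .ite_false (.head _ _) (.tail _ _)⟩
      · exact ⟨5, by simp, .ite_true (.head _ _) (.seq (.head _ _) (.head _ _))⟩
  exact this.comp (hf.prodMk hg)

@[fun_prop] theorem isEmpty {f : α → List β} (hf : PolyTime f) :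
    PolyTime (fun a => (f a).isEmpty) := by
  have : PolyTime (fun l : List β => l.isEmpty) := by
    refine of_bounds (.ite .skip .nil (.cons .nil .nil)) 3 5 (fun l => ?_) fun l => ?_
    · simpa using sz_bool_le _
    · rcases l with _ | ⟨a, l⟩
      · exact ⟨5, by simp, .ite_false (.skip _) (.cons (.nil _) (.nil _))⟩
      · exact ⟨3, by simp, .ite_true (.skip _) (.nil _)⟩
  exact this.comp hf

@[fun_prop] theorem cond {c : α → Bool} {f g : α → β} (hc : PolyTime c) (hf : PolyTime f)
    (hg : PolyTime g) : PolyTime (fun a => bif c a then f a else g a) := by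
  obtain ⟨R, r, hR⟩ := hc
  obtain ⟨P, p, hP⟩ := hf
  obtain ⟨Q, q, hQ⟩ := hg
  refine ⟨.ite R P Q, r + p + q + 1, fun a => ⟨?_, ?_⟩⟩
  · have h₁ := (hP a).1
    have h₂ := (hQ a).1
    cases h : c a
    · simp only [h, cond_false, Polynomial.eval_add, Polynomial.eval_one]
      omega
    · simp only [h, cond_true, Polynomial.eval_add, Polynomial.eval_one]
      omega
  · obtain ⟨k, hk, hk'⟩ := (hR a).2
    obtain ⟨s, hs, hs'⟩ := (hP a).2
    obtain ⟨t, ht, ht'⟩ := (hQ a).2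
    cases h : c a <;> rw [h] at hk'
    · simp only [h, cond_false, Polynomial.eval_add, Polynomial.eval_one]
      exact ⟨_, by omega, .ite_false hk' ht'⟩
    · simp only [h, cond_true, Polynomial.eval_add, Polynomial.eval_one]
      exact ⟨_, by omega, .ite_true hk' hs'⟩

/-- The program that folds the step computed by `P` over a list. -/
def foldProg (P : Prog) : Prog :=
  .loop (.seq .tail .head) (.cons .head (.cons (.seq .tail (.seq .head .tail))
    (.seq (.cons .head (.cons (.seq .tail .tail) (.seq .tail (.seq .head .head)))) P)))

/-- The loop state is the triple of context, unread list and accumulator. Each round costs 24 steps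
besides those of `P`, and the final test and exit cost 4. -/
theorem run_foldProg {P : Prog} {M : ℕ} {g : γ → β → α → β} {c : γ} (l : List α) (b : β)
    (h : ∀ l₁ a l₂, l = l₁ ++ a :: l₂ → ∃ t ≤ M,
      Run P (enc (c, l₁.foldl (g c) b, a)) (enc (g c (l₁.foldl (g c) b) a)) t) :
    ∃ t ≤ l.length * (M + 24) + 4,
      Run (foldProg P) (enc (c, l, b)) (enc (c, ([] : List α), l.foldl (g c) b)) t := by
  induction l generalizing b with
  | nil => exact ⟨4, by simp, .loop_exit (.seq (.tail _ _) (.head _ _))⟩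
  | cons a l ih =>
    obtain ⟨s, hs, hs'⟩ := h [] a l rfl
    obtain ⟨t, ht, ht'⟩ := ih (g c b a) fun l₁ a' l₂ hl => h (a :: l₁) a' l₂ (by simp [hl])
    refine ⟨_, ?_, .loop_next (.seq (.tail _ _) (.head _ _))
      (.cons (.head _ _) (.cons (.seq (.tail _ _) (.seq (.head _ _) (.tail _ _)))
        (.seq (.cons (.head _ _) (.cons (.seq (.tail _ _) (.tail _ _))
          (.seq (.tail _ _) (.seq (.head _ _) (.head _ _))))) hs'))) ht'⟩
    simp only [List.length_cons, add_mul, one_mul] at *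
    omega

/-- Polynomial growth per step may compound to exponential growth, so `hb` bounds the accumulator
after every prefix of the list. -/
theorem foldl {g : γ → β → α → β} {l : γ → List α} {i : γ → β}
    (hg : PolyTime (fun p : γ × β × α => g p.1 p.2.1 p.2.2)) (hl : PolyTime l) (hi : PolyTime i)
    (hb : ∃ p : Polynomial ℕ, ∀ c l₁, l₁ <+: l c → sz (l₁.foldl (g c) (i c)) ≤ p.eval (sz c)) :
    PolyTime (fun c => (l c).foldl (g c) (i c)) := by
  obtain ⟨P, p, hP⟩ := hg
  obtain ⟨q, hq⟩ := hb
  obtain ⟨r, hr⟩ := hl.size_le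
  obtain ⟨Q, u, hQ⟩ := (id' (α := γ)).prodMk (hl.prodMk hi)
  refine of_bounds (.seq Q (.seq (foldProg P) (.seq .tail .tail))) q
    (u + (r * (p.comp (.X + (q + r + 1) + 1) + 24) + 4) + 5)
    (fun c => hq c _ (List.prefix_refl _)) fun c => ?_
  obtain ⟨s, hs, hs'⟩ := (hQ c).2
  obtain ⟨t, ht, ht'⟩ := run_foldProg (P := P) (g := g) (c := c)
    (M := (p.comp (.X + (q + r + 1) + 1)).eval (sz c)) (l c) (i c) fun l₁ a l₂ h => by
      obtain ⟨t, ht, ht'⟩ := (hP (c, l₁.foldl (g c) (i c), a)).2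
      refine ⟨t, ht.trans ?_, ht'⟩
      rw [Polynomial.eval_comp]
      apply p.eval_mono_nat
      have h₁ := hq c l₁ ⟨_, h.symm⟩
      have h₂ := (sz_le_of_mem (show a ∈ l c by simp [h])).trans (hr c)
      simp
      omega
  refine ⟨_, ?_, .seq hs' (.seq ht' (.seq (.tail _ _) (.tail _ _)))⟩
  have h₁ : (l c).length ≤ r.eval (sz c) := (length_lt_sz _).le.trans (hr c)
  have h₂ := Nat.mul_le_mul_right ((p.comp (.X + (q + r + 1) + 1)).eval (sz c) + 24) h₁
  have h₃ : (24 : Polynomial ℕ).eval (sz c) = 24 := by simp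
  have h₄ : (4 : Polynomial ℕ).eval (sz c) = 4 := by simp
  have h₅ : (5 : Polynomial ℕ).eval (sz c) = 5 := by simp
  simp only [Polynomial.eval_add, Polynomial.eval_mul, h₃, h₄, h₅]
  omega

/-- A fold is computable in polynomial time if each step adds an amount to the size that is bounded
in terms of the context and the current element. -/
theorem foldl_of_add {g : γ → β → α → β} {l : γ → List α} {i : γ → β}
    (hg : PolyTime (fun p : γ × β × α => g p.1 p.2.1 p.2.2)) (hl : PolyTime l) (hi : PolyTime i)
    (hb : ∃ p : Polynomial ℕ, ∀ c b a, sz (g c b a) ≤ sz b + p.eval (sz (c, a))) :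
    PolyTime (fun c => (l c).foldl (g c) (i c)) := by
  refine foldl hg hl hi ?_
  obtain ⟨p, hp⟩ := hb
  obtain ⟨q, hq⟩ := hi.size_le
  obtain ⟨r, hr⟩ := hl.size_le
  refine ⟨q + r * p.comp (.X + r + 1), fun c l₁ h₁ => ?_⟩
  have key : ∀ (l₂ : List α) (b : β), (∀ a ∈ l₂, a ∈ l c) →
      sz (l₂.foldl (g c) b) ≤ sz b + l₂.length * (p.comp (.X + r + 1)).eval (sz c) := by
    intro l₂
    induction l₂ with
    | nil => simp
    | cons a l₂ ih =>
      intro b h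
      have h₂ := ih (g c b a) fun a' h' => h a' (List.mem_cons_of_mem _ h')
      have h₃ := hp c b a
      have h₄ : p.eval (sz (c, a)) ≤ (p.comp (.X + r + 1)).eval (sz c) := by
        rw [Polynomial.eval_comp]
        apply p.eval_mono_nat
        have := (sz_le_of_mem (h a List.mem_cons_self)).trans (hr c)
        simp
        omega
      simp only [List.foldl_cons, List.length_cons, add_mul, one_mul]
      omega
  have h₂ := key l₁ (i c) fun a ha => h₁.subset ha
  have h₃ : l₁.length ≤ r.eval (sz c) :=
    h₁.length_le.trans ((length_lt_sz _).le.trans (hr c))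
  have h₄ := Nat.mul_le_mul_right ((p.comp (.X + r + 1)).eval (sz c)) h₃
  have h₅ := hq c
  simp only [Polynomial.eval_add, Polynomial.eval_mul]
  omega

theorem foldl_replicate {ι : Type} (f : ι → ι) (n : ℕ) (b : ι) :
    (List.replicate n ()).foldl (fun b _ => f b) b = f^[n] b := by
  induction n generalizing b with
  | zero => rfl
  | succ n ih => simp [List.replicate_succ, ih]

theorem replicate_unit {n : γ → ℕ} (hn : PolyTime n) :
    PolyTime (fun c => List.replicate (n c) ()) :=
  (of_enc_eq (f := fun n : ℕ => List.replicate n ()) enc_replicate).comp hn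

/-- A unary number has the same code as a list of units, so iteration is a fold. -/
theorem iterate {g : γ → β → β} {n : γ → ℕ} {i : γ → β}
    (hg : PolyTime (fun p : γ × β => g p.1 p.2)) (hn : PolyTime n) (hi : PolyTime i)
    (hb : ∃ p : Polynomial ℕ, ∀ c, ∀ k ≤ n c, sz ((g c)^[k] (i c)) ≤ p.eval (sz c)) :
    PolyTime (fun c => (g c)^[n c] (i c)) := by
  have h := foldl (g := fun c b (_ : Unit) => g c b) (l := fun c => List.replicate (n c) ())
    (i := i) (hg.comp (by fun_prop : PolyTime fun p : γ × β × Unit => (p.1, p.2.1)))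
    (replicate_unit hn) hi ?_
  · simpa only [foldl_replicate] using h
  · obtain ⟨p, hp⟩ := hb
    refine ⟨p, fun c l₁ h₁ => ?_⟩
    rw [List.prefix_replicate_iff] at h₁
    rw [h₁.2, foldl_replicate]
    exact hp c _ h₁.1

theorem iterate_of_add {g : γ → β → β} {n : γ → ℕ} {i : γ → β}
    (hg : PolyTime (fun p : γ × β => g p.1 p.2)) (hn : PolyTime n) (hi : PolyTime i)
    (hb : ∃ p : Polynomial ℕ, ∀ c b, sz (g c b) ≤ sz b + p.eval (sz c)) :
    PolyTime (fun c => (g c)^[n c] (i c)) := by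
  have h := foldl_of_add (g := fun c b (_ : Unit) => g c b)
    (l := fun c => List.replicate (n c) ())
    (i := i) (hg.comp (by fun_prop : PolyTime fun p : γ × β × Unit => (p.1, p.2.1)))
    (replicate_unit hn) hi ?_
  · simpa only [foldl_replicate] using h
  · obtain ⟨p, hp⟩ := hb
    refine ⟨p, fun c b a => (hp c b).trans ?_⟩
    gcongr
    apply p.eval_mono_nat
    simp
    omega

/-! ### List operations and unary arithmetic in polynomial time. -/

@[fun_prop] theorem reverse {l : γ → List α} (hl : PolyTime l) :
    PolyTime (fun c => (l c).reverse) := by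
  have := foldl_of_add (g := fun (_ : γ) (b : List α) a => a :: b) (l := l) (i := fun _ => [])
    (by fun_prop) hl (by fun_prop) ⟨.X, fun c b a => by simp; omega⟩
  simpa using this

@[fun_prop] theorem append {l l' : γ → List α} (hl : PolyTime l) (hl' : PolyTime l') :
    PolyTime (fun c => l c ++ l' c) := by
  have := foldl_of_add (g := fun (_ : γ) (b : List α) a => a :: b) (l := fun c => (l c).reverse)
    (i := l') (by fun_prop) (by fun_prop) hl' ⟨.X, fun c b a => by simp; omega⟩
  simpa using this

@[fun_prop] theorem not {p : γ → Bool} (hp : PolyTime p) : PolyTime (fun c => !p c) := by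
  have : (fun c => !p c) = fun c => bif p c then false else true := by
    funext c; cases p c <;> rfl
  rw [this]; fun_prop

@[fun_prop] theorem and {p q : γ → Bool} (hp : PolyTime p) (hq : PolyTime q) :
    PolyTime (fun c => p c && q c) := by
  have : (fun c => p c && q c) = fun c => bif p c then q c else false := by
    funext c; cases p c <;> rfl
  rw [this]; fun_prop

theorem flatMap {l : γ → List α} {f : γ → α → List β}
    (hf : PolyTime (fun p : γ × α => f p.1 p.2)) (hl : PolyTime l) :
    PolyTime (fun c => (l c).flatMap (f c)) := by
  obtain ⟨p, hp⟩ := hf.size_le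
  have := foldl_of_add (g := fun (c : γ) (b : List β) (a : α) => b ++ f c a) (l := l)
    (i := fun _ => []) (append (by fun_prop) (hf.comp (by fun_prop :
      PolyTime fun q : γ × List β × α => (q.1, q.2.2)))) hl (by fun_prop)
    ⟨p, fun c b a => by have := hp (c, a); have := sz_append b (f c a); dsimp only at *; omega⟩
  have key : ∀ c (l : List α) (b : List β),
      l.foldl (fun b a => b ++ f c a) b = b ++ l.flatMap (f c) := by
    intro c l
    induction l with
    | nil => simp
    | cons a l ih => intro b; simp [ih]
  simpa [key] using this

theorem map {l : γ → List α} {f : γ → α → β}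
    (hf : PolyTime (fun p : γ × α => f p.1 p.2)) (hl : PolyTime l) :
    PolyTime (fun c => (l c).map (f c)) := by
  have := flatMap (f := fun c a => [f c a]) (by fun_prop) hl
  have key : ∀ c (l : List α), l.flatMap (fun a => [f c a]) = l.map (f c) := by
    intro c l
    induction l with
    | nil => rfl
    | cons a l ih => simp [ih]
  simpa only [key] using this

theorem filter {l : γ → List α} {f : γ → α → Bool}
    (hf : PolyTime (fun p : γ × α => f p.1 p.2)) (hl : PolyTime l) :
    PolyTime (fun c => (l c).filter (f c)) := by
  have := flatMap (f := fun c a => bif f c a then [a] else []) (by fun_prop) hl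
  have key : ∀ c (l : List α), l.flatMap (fun a => bif f c a then [a] else []) = l.filter (f c) := by
    intro c l
    induction l with
    | nil => rfl
    | cons a l ih => cases h : f c a <;> simp [h, ← ih]
  simpa only [key] using this

theorem all {l : γ → List α} {f : γ → α → Bool}
    (hf : PolyTime (fun p : γ × α => f p.1 p.2)) (hl : PolyTime l) :
    PolyTime (fun c => (l c).all (f c)) := by
  have := (filter (f := fun c a => !f c a) (by fun_prop) hl).isEmpty
  have key : ∀ c (l : List α), (l.filter fun a => !f c a).isEmpty = l.all (f c) := by
    intro c l
    induction l with
    | nil => rfl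
    | cons a l ih => cases h : f c a <;> simp [h, ← ih]
  simpa only [key] using this

@[fun_prop] theorem length {l : γ → List α} (hl : PolyTime l) :
    PolyTime (fun c => (l c).length) := by
  have := of_enc_eq (f := fun l : List Unit => l.length) (fun l => by
    rw [← enc_replicate, show List.replicate l.length () = l from
      (List.eq_replicate_of_mem fun a _ => rfl).symm])
  have := this.comp (map (f := fun (_ : γ) (_ : α) => ()) (by fun_prop) hl)
  simpa using this

@[fun_prop] theorem add {f g : γ → ℕ} (hf : PolyTime f) (hg : PolyTime g) :
    PolyTime (fun c => f c + g c) := by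
  have := iterate_of_add (g := fun (_ : γ) n => n + 1) (i := f) (by fun_prop) hg hf
    ⟨2, fun c b => by simp [mul_add]⟩
  simpa using this

@[fun_prop] theorem sub {f g : γ → ℕ} (hf : PolyTime f) (hg : PolyTime g) :
    PolyTime (fun c => f c - g c) := by
  have := iterate_of_add (g := fun (_ : γ) n => Nat.pred n) (i := f) (by fun_prop) hg hf
    ⟨0, fun c b => by simp⟩
  simpa only [Nat.pred_iterate] using this

@[fun_prop] theorem mul {f g : γ → ℕ} (hf : PolyTime f) (hg : PolyTime g) :
    PolyTime (fun c => f c * g c) := by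
  obtain ⟨p, hp⟩ := hf.size_le
  have := iterate_of_add (g := fun (c : γ) n => n + f c) (n := g) (i := fun _ => 0)
    (add (by fun_prop) (hf.comp fst)) hg (by fun_prop)
    ⟨p, fun c b => by have := hp c; simp at *; omega⟩
  simpa [mul_comm] using this

@[fun_prop] theorem pow {f : γ → ℕ} (hf : PolyTime f) (k : ℕ) :
    PolyTime (fun c => f c ^ k) := by
  induction k with
  | zero => simp only [pow_zero]; fun_prop
  | succ k ih => simp only [pow_succ]; fun_prop

@[fun_prop] theorem drop {n : γ → ℕ} {l : γ → List α} (hn : PolyTime n) (hl : PolyTime l) :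
    PolyTime (fun c => (l c).drop (n c)) := by
  have := iterate_of_add (g := fun (_ : γ) (b : List α) => b.tail) (i := l) (by fun_prop) hn hl
    ⟨0, fun c b => by cases b <;> simp; omega⟩
  have key : ∀ k (l : List α), (fun b : List α => b.tail)^[k] l = l.drop k := by
    intro k
    induction k with
    | zero => simp
    | succ k ih => intro l; cases l <;> simp [ih]
  simpa only [key] using this

@[fun_prop] theorem take {n : γ → ℕ} {l : γ → List α} (hn : PolyTime n) (hl : PolyTime l) :
    PolyTime (fun c => (l c).take (n c)) := by
  have : (fun c => (l c).take (n c)) =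
      fun c => ((l c).reverse.drop ((l c).length - n c)).reverse := by
    funext c
    rw [List.drop_reverse, List.reverse_reverse]
    rcases le_total (n c) (l c).length with h | h
    · congr 1; omega
    · rw [List.take_of_length_le h, List.take_of_length_le (by omega)]
  rw [this]; fun_prop

theorem sz_range_le (n : ℕ) : sz (List.range n) ≤ n * (2 * n + 2) + 1 := by
  have : ∀ k ≤ n, sz (List.range k) ≤ k * (2 * n + 2) + 1 := by
    intro k
    induction k with
    | zero => simp
    | succ k ih =>
      intro h
      have h₁ := ih (by omega)
      have h₂ := sz_append (List.range k) [k]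
      rw [← List.range_succ] at h₂
      simp at h₂
      simp only [add_mul, one_mul]
      omega
  exact this n le_rfl

@[fun_prop] theorem range {n : γ → ℕ} (hn : PolyTime n) :
    PolyTime (fun c => List.range (n c)) := by
  have key : ∀ k, (fun l : List ℕ => l ++ [l.length])^[k] [] = List.range k := by
    intro k
    induction k with
    | zero => rfl
    | succ k ih => rw [Function.iterate_succ_apply', ih, List.range_succ]; simp
  obtain ⟨p, hp⟩ := hn.size_le
  have := iterate (g := fun (_ : γ) (l : List ℕ) => l ++ [l.length]) (i := fun _ => [])
    (by fun_prop) hn (by fun_prop) ⟨p * (p + p + 2) + 1, fun c k hk => by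
      rw [key]
      have h₁ := hp c
      have h₂ := sz_range_le k
      have h₃ : k ≤ p.eval (sz c) := by simp at h₁; omega
      simp
      nlinarith⟩
  simpa only [key] using this

@[fun_prop] theorem listBeq [BEq α] {l l' : γ → List α}
    (h : PolyTime (fun p : α × α => p.1 == p.2)) (hl : PolyTime l) (hl' : PolyTime l') :
    PolyTime (fun c => l c == l' c) := by
  -- The state is a flag and the unmatched rest of the other list. The default of `headD` is
  -- harmless: an empty rest already makes the flag false.
  have key : ∀ (l l' : List α) (ok : Bool),
      (let r := l.foldl (fun (s : Bool × List α) a =>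
        ((s.1 && !s.2.isEmpty) && s.2.headD a == a, s.2.tail)) (ok, l')
       r.1 && r.2.isEmpty) = (ok && l' == l) := by
    intro l
    induction l with
    | nil => intro l' ok; cases l' <;> simp
    | cons a l ih =>
      intro l' ok
      cases l' with
      | nil => simp only [List.foldl_cons, ih]; simp
      | cons b l' => simp only [List.foldl_cons, ih]; simp [Bool.and_assoc]
  have hfold := foldl_of_add (g := fun (_ : γ) (s : Bool × List α) a =>
        ((s.1 && !s.2.isEmpty) && s.2.headD a == a, s.2.tail)) (l := l') (i := fun c => (true, l c))
    (prodMk (and (by fun_prop) (h.comp (by fun_prop : PolyTime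
      fun p : γ × (Bool × List α) × α => (p.2.1.2.headD p.2.2, p.2.2)))) (by fun_prop)) hl'
    (by fun_prop) ⟨3, fun c b a => by
      obtain ⟨ok, l⟩ := b
      have h₁ := sz_bool_le ((ok && !l.isEmpty) && l.headD a == a)
      have h₂ : sz l.tail ≤ sz l := by cases l <;> simp; omega
      simp only [sz_pair, Polynomial.eval_ofNat]
      omega⟩
  have := (fst.comp hfold).and (snd.comp hfold).isEmpty
  simpa only [key, Bool.true_and] using this

end PolyTime

/-! ### Bounded search and binary expansions. -/

/-- The least number with a property, if there is one up to `B`, found by counting upwards. -/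
def search (good : ℕ → Bool) (B : ℕ) : ℕ := (fun q => bif good q then q else q + 1)^[B] 0

theorem search_le (good : ℕ → Bool) (B : ℕ) : search good B ≤ B := by
  unfold search
  induction B with
  | zero => simp
  | succ B ih =>
    rw [Function.iterate_succ_apply']
    cases good ((fun q => bif good q then q else q + 1)^[B] 0) <;> simp <;> omega

theorem search_eq {good : ℕ → Bool} {k B : ℕ} (hk : good k = true)
    (h : ∀ j < k, good j = false) (hB : k ≤ B) : search good B = k := by
  have h₁ : ∀ j ≤ k, search good j = j := by
    intro j
    induction j with
    | zero => intro _; rfl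
    | succ j ih =>
      intro hj
      have := ih (by omega)
      unfold search at this ⊢
      rw [Function.iterate_succ_apply', this, h j (by omega)]
      rfl
  obtain ⟨d, rfl⟩ := Nat.exists_eq_add_of_le hB
  clear hB
  induction d with
  | zero => exact h₁ k le_rfl
  | succ d ih =>
    unfold search at ih ⊢
    rw [← add_assoc, Function.iterate_succ_apply', ih, hk]
    rfl

theorem search_spec {good : ℕ → Bool} {B : ℕ} (h : ∃ q ≤ B, good q = true) :
    good (search good B) = true := by
  classical
  obtain ⟨q, hq, hq'⟩ := h
  have hex : ∃ q, good q = true := ⟨q, hq'⟩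
  rw [search_eq (Nat.find_spec hex) (fun j hj => by simpa using Nat.find_min hex hj)
    ((Nat.find_min' hex hq').trans hq)]
  exact Nat.find_spec hex

/-- The `w` lowest binary digits of a number. -/
def bits (w q : ℕ) : List Bool := (List.range w).map fun i => q.testBit i

@[simp] theorem length_bits (w q : ℕ) : (bits w q).length = w := by simp [bits]

theorem bits_injective {w q r : ℕ} (hq : q < 2 ^ w) (hr : r < 2 ^ w) (h : bits w q = bits w r) :
    q = r := by
  refine Nat.eq_of_testBit_eq fun i => ?_
  by_cases hi : i < w
  · exact List.map_inj_left.1 h i (List.mem_range.2 hi)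
  · have := Nat.pow_le_pow_right (n := 2) two_pos (not_lt.1 hi)
    rw [Nat.testBit_lt_two_pow (by omega), Nat.testBit_lt_two_pow (by omega)]

/-- The number with the given binary expansion, most significant digit first. -/
def binVal (x : List Bool) : ℕ := x.foldl (fun r c => 2 * r + c.toNat) 0

theorem binVal_concat (x : List Bool) (c : Bool) : binVal (x ++ [c]) = 2 * binVal x + c.toNat := by
  simp [binVal]

theorem binVal_lt (x : List Bool) : binVal x < 2 ^ x.length := by
  induction x using List.reverseRecOn with
  | nil => simp [binVal]
  | append_singleton x c ih =>
    rw [binVal_concat, List.length_append, List.length_singleton, pow_succ]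
    have := Bool.toNat_le c
    omega

theorem binVal_injective {x y : List Bool} (hxy : x.length = y.length)
    (h : binVal x = binVal y) : x = y := by
  induction x using List.reverseRecOn generalizing y with
  | nil => exact (List.length_eq_zero_iff.1 hxy.symm).symm
  | append_singleton x c ih =>
    rcases List.eq_nil_or_concat y with rfl | ⟨y, d, rfl⟩
    · simp at hxy
    · rw [List.concat_eq_append] at *
      simp only [List.length_append, List.length_singleton, add_left_inj] at hxy
      rw [binVal_concat, binVal_concat] at h
      have h₁ := Bool.toNat_le c
      have h₂ := Bool.toNat_le d
      have h₃ : c.toNat = d.toNat := by omega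
      rw [ih hxy (by omega), show c = d by cases c <;> cases d <;> simp_all]

/-- Horner's scheme may be reduced after every digit. This matters because the unary code of `binVal
x` can be exponentially long, while its residues stay small. -/
theorem binVal_mod (x : List Bool) (m : ℕ) :
    x.foldl (fun r c => (2 * r + c.toNat) % m) 0 % m = binVal x % m := by
  induction x using List.reverseRecOn with
  | nil => rfl
  | append_singleton x c ih =>
    rw [binVal_concat, List.foldl_append, List.foldl_cons, List.foldl_nil, Nat.mod_mod,
      Nat.add_mod, Nat.mul_mod, ih, ← Nat.mul_mod, ← Nat.add_mod]

/-! ### Division, logarithms and residues in polynomial time. -/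

namespace PolyTime

variable {α β γ : Type} [Enc α] [Enc β] [Enc γ]

@[fun_prop] theorem search {good : γ → ℕ → Bool} {B : γ → ℕ}
    (hg : PolyTime (fun p : γ × ℕ => good p.1 p.2)) (hB : PolyTime B) :
    PolyTime (fun c => search (good c) (B c)) :=
  iterate_of_add (g := fun c q => bif good c q then q else q + 1) (i := fun _ => 0)
    (by fun_prop) hB (by fun_prop)
    ⟨2, fun c b => by cases good c b <;> simp [mul_add]⟩

@[fun_prop] theorem decide_lt {f g : γ → ℕ} (hf : PolyTime f) (hg : PolyTime g) :
    PolyTime (fun c => decide (f c < g c)) := by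
  have : (fun c => decide (f c < g c)) =
      fun c => !(List.replicate (g c - f c) ()).isEmpty := by
    funext c
    rw [Bool.eq_iff_iff]
    simp
    omega
  rw [this]
  have := replicate_unit (hg.sub hf)
  fun_prop

@[fun_prop] theorem natBeq {f g : γ → ℕ} (hf : PolyTime f) (hg : PolyTime g) :
    PolyTime (fun c => f c == g c) := by
  have : (fun c => f c == g c) = fun c => (!decide (f c < g c)) && !decide (g c < f c) := by
    funext c
    rw [Bool.eq_iff_iff]
    simp
    omega
  rw [this]
  fun_prop

theorem boolBeq {f g : γ → Bool} (hf : PolyTime f) (hg : PolyTime g) :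
    PolyTime (fun c => f c == g c) := by
  have : (fun c => f c == g c) = fun c => bif f c then g c else !g c := by
    funext c
    cases f c <;> cases g c <;> rfl
  rw [this]
  fun_prop

@[fun_prop] theorem stringBeq {f g : γ → List Bool} (hf : PolyTime f) (hg : PolyTime g) :
    PolyTime (fun c => f c == g c) := listBeq (boolBeq fst snd) hf hg

-- The quotient is the least `h` with `f c < (h + 1) * (g c + 1)`. Writing the divisor as a
-- successor avoids division by zero.
@[fun_prop] theorem div_succ {f g : γ → ℕ} (hf : PolyTime f) (hg : PolyTime g) :
    PolyTime (fun c => f c / (g c + 1)) := by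
  have : (fun c => f c / (g c + 1)) =
      fun c => _root_.search (fun h => decide (f c < (h + 1) * (g c + 1))) (f c) := by
    funext c
    refine (search_eq ?_ (fun j hj => ?_) (Nat.div_le_self _ _)).symm
    · simpa [mul_comm] using Nat.lt_mul_div_succ (f c) (Nat.succ_pos (g c))
    · simpa using (Nat.le_div_iff_mul_le (Nat.succ_pos (g c))).1 hj
  rw [this]
  exact search (by fun_prop) hf

@[fun_prop] theorem mod_succ {f g : γ → ℕ} (hf : PolyTime f) (hg : PolyTime g) :
    PolyTime (fun c => f c % (g c + 1)) := by
  have : (fun c => f c % (g c + 1)) = fun c => f c - (g c + 1) * (f c / (g c + 1)) := by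
    funext c
    exact Nat.mod_eq_sub _ _
  rw [this]
  fun_prop

@[fun_prop] theorem toNat {f : γ → Bool} (hf : PolyTime f) : PolyTime (fun c => (f c).toNat) := by
  have : (fun c => (f c).toNat) = fun c => bif f c then 1 else 0 := rfl
  rw [this]
  fun_prop

theorem div_two_iterate (q i : ℕ) : (fun q => q / 2)^[i] q = q / 2 ^ i := by
  induction i with
  | zero => simp
  | succ i ih => rw [Function.iterate_succ_apply', ih, Nat.div_div_eq_div_mul, pow_succ]

-- Repeated halving avoids forming `2 ^ g c`, whose unary code could be exponentially long.
@[fun_prop] theorem div_two_pow {f g : γ → ℕ} (hf : PolyTime f) (hg : PolyTime g) :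
    PolyTime (fun c => f c / 2 ^ g c) := by
  have : PolyTime (fun p : γ × ℕ => p.2 / (1 + 1)) := by fun_prop
  have := iterate_of_add (g := fun (_ : γ) q => q / 2) (i := f) this hg hf
    ⟨0, fun c b => by simp; omega⟩
  simpa only [div_two_iterate] using this

@[fun_prop] theorem log_two {f : γ → ℕ} (hf : PolyTime f) :
    PolyTime (fun c => Nat.log 2 (f c)) := by
  have : (fun c => Nat.log 2 (f c)) =
      fun c => _root_.search (fun k => decide (f c / 2 ^ (k + 1) < 1)) (f c) := by
    funext c
    refine (search_eq ?_ (fun j hj => ?_) (Nat.log_le_self _ _)).symm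
    · simpa using Nat.lt_pow_succ_log_self one_lt_two (f c)
    · have h₀ : f c ≠ 0 := by rintro h; simp [h] at hj
      simpa using Nat.pow_le_of_le_log h₀ hj
  rw [this]
  exact search (by fun_prop) hf

@[fun_prop] theorem bits {f g : γ → ℕ} (hf : PolyTime f) (hg : PolyTime g) :
    PolyTime (fun c => bits (f c) (g c)) := by
  have : (fun c => _root_.bits (f c) (g c)) =
      fun c => (List.range (f c)).map (fun i => (g c / 2 ^ i) % (1 + 1) == 1) := by
    funext c
    refine List.map_congr_left fun i _ => ?_
    rw [Nat.testBit_eq_decide_div_mod_eq]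
    rfl
  rw [this]
  exact map (by fun_prop) (by fun_prop)

@[fun_prop] theorem binVal_mod_succ {f : γ → List Bool} {g : γ → ℕ} (hf : PolyTime f)
    (hg : PolyTime g) : PolyTime (fun c => binVal (f c) % (g c + 1)) := by
  obtain ⟨p, hp⟩ := hg.size_le
  have : PolyTime (fun c => (f c).foldl (fun r b => (2 * r + b.toNat) % (g c + 1)) 0) := by
    refine foldl (g := fun c r b => (2 * r + b.toNat) % (g c + 1)) (i := fun _ => 0)
      (by fun_prop) hf (by fun_prop) ⟨2 * p + 1, fun c l _ => ?_⟩
    have h : l.foldl (fun r b => (2 * r + b.toNat) % (g c + 1)) 0 ≤ g c := by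
      induction l using List.reverseRecOn with
      | nil => simp
      | append_singleton l b ih =>
        rw [List.foldl_append, List.foldl_cons, List.foldl_nil]
        exact Nat.le_of_lt_succ (Nat.mod_lt _ (Nat.succ_pos _))
    have := hp c
    simp at *
    omega
  simp only [← binVal_mod]
  fun_prop

end PolyTime

/-! ### Edit balls: enumeration and cardinality. -/

theorem EditStep.symm {m : EditModel} {x y : List Bool} (h : EditStep m x y) : EditStep m y x := by
  cases h with
  | insertion _ u v c => exact .deletion _ u v c
  | deletion _ u v c => exact .insertion _ u v c
  | substitution u v c d => exact .substitution u v d c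

theorem EditsWithin.snoc {m : EditModel} {k : ℕ} {x y z : List Bool} (h : EditsWithin m k x y)
    (h' : EditStep m y z) : EditsWithin m (k + 1) x z := by
  induction h with
  | refl k x => exact .step h' (.refl k _)
  | step h₁ _ ih => exact .step h₁ (ih h')

theorem EditsWithin.symm {m : EditModel} {k : ℕ} {x y : List Bool} (h : EditsWithin m k x y) :
    EditsWithin m k y x := by
  induction h with
  | refl k x => exact .refl k x
  | step h₁ _ ih => exact ih.snoc h₁.symm

theorem EditsWithin.succ {m : EditModel} {k : ℕ} {x y : List Bool} (h : EditsWithin m k x y) :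
    EditsWithin m (k + 1) x y := by
  induction h with
  | refl k x => exact .refl _ x
  | step h₁ _ ih => exact .step h₁ ih

/-- The results of at most one edit at the border between `u` and `v` of the string `u ++ v`. -/
def editsAt (m : EditModel) (u v : List Bool) : List (List Bool) :=
  [u ++ v, u ++ false :: v, u ++ true :: v, u ++ v.tail] ++
    match m with
    | .insDel => []
    | .insDelSub => [u ++ false :: v.tail, u ++ true :: v.tail]

/-- The results of at most one edit. -/
def neighbors (m : EditModel) (x : List Bool) : List (List Bool) :=
  (List.range (x.length + 1)).flatMap fun i => editsAt m (x.take i) (x.drop i)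

/-- The results of at most `k` edits. -/
def editBall (m : EditModel) : ℕ → List Bool → List (List Bool)
  | 0, x => [x]
  | k + 1, x => (neighbors m x).flatMap (editBall m k)

theorem mem_neighbors {m : EditModel} {x y : List Bool} :
    y ∈ neighbors m x ↔ ∃ u v, x = u ++ v ∧ y ∈ editsAt m u v := by
  simp only [neighbors, List.mem_flatMap, List.mem_range]
  constructor
  · rintro ⟨i, _, h⟩
    exact ⟨_, _, (List.take_append_drop i x).symm, h⟩
  · rintro ⟨u, v, rfl, h⟩
    exact ⟨u.length, by simp, by simpa using h⟩

theorem self_mem_neighbors (m : EditModel) (x : List Bool) : x ∈ neighbors m x :=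
  mem_neighbors.2 ⟨[], x, rfl, by simp [editsAt]⟩

theorem EditStep.mem_neighbors {m : EditModel} {x y : List Bool} (h : EditStep m x y) :
    y ∈ neighbors m x := by
  cases h with
  | insertion _ u v c => exact _root_.mem_neighbors.2 ⟨u, v, rfl, by cases c <;> simp [editsAt]⟩
  | deletion _ u v c => exact _root_.mem_neighbors.2 ⟨u, c :: v, rfl, by simp [editsAt]⟩
  | substitution u v c d =>
    exact _root_.mem_neighbors.2 ⟨u, c :: v, rfl, by cases d <;> simp [editsAt]⟩

theorem eq_or_editStep_of_mem_neighbors {m : EditModel} {x y : List Bool}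
    (h : y ∈ neighbors m x) : y = x ∨ EditStep m x y := by
  obtain ⟨u, v, rfl, hy⟩ := mem_neighbors.1 h
  have ht : u ++ v.tail = u ++ v ∨ EditStep m (u ++ v) (u ++ v.tail) := by
    cases v with
    | nil => exact .inl rfl
    | cons c v => exact .inr (.deletion m u v c)
  cases m with
  | insDel =>
    replace hy : y ∈ [u ++ v, u ++ false :: v, u ++ true :: v, u ++ v.tail] := hy
    simp only [List.mem_cons, List.not_mem_nil, or_false] at hy
    rcases hy with rfl | rfl | rfl | rfl
    · exact .inl rfl
    · exact .inr (.insertion _ u v _)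
    · exact .inr (.insertion _ u v _)
    · exact ht
  | insDelSub =>
    -- At the end of the string, the listed substitution is really an insertion, which is still one
    -- edit.
    have hs c : EditStep .insDelSub (u ++ v) (u ++ c :: v.tail) := by
      cases v with
      | nil => exact .insertion _ u [] c
      | cons d v => exact .substitution u v d c
    replace hy : y ∈ [u ++ v, u ++ false :: v, u ++ true :: v, u ++ v.tail,
      u ++ false :: v.tail, u ++ true :: v.tail] := hy
    simp only [List.mem_cons, List.not_mem_nil, or_false] at hy
    rcases hy with rfl | rfl | rfl | rfl | rfl | rfl
    · exact .inl rfl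
    · exact .inr (.insertion _ u v _)
    · exact .inr (.insertion _ u v _)
    · exact ht
    · exact .inr (hs _)
    · exact .inr (hs _)

theorem mem_editBall {m : EditModel} {k : ℕ} {x y : List Bool} :
    y ∈ editBall m k x ↔ EditsWithin m k x y := by
  induction k generalizing x with
  | zero =>
    simp only [editBall, List.mem_singleton]
    constructor
    · rintro rfl
      exact .refl _ _
    · intro h
      cases h
      rfl
  | succ k ih =>
    simp only [editBall, List.mem_flatMap, ih]
    constructor
    · rintro ⟨z, hz, hy⟩
      rcases eq_or_editStep_of_mem_neighbors hz with rfl | h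
      · exact hy.succ
      · exact .step h hy
    · intro h
      cases h with
      | refl => exact ⟨_, self_mem_neighbors _ _, .refl _ _⟩
      | step h₁ h₂ => exact ⟨_, h₁.mem_neighbors, h₂⟩

theorem editBall_add (m : EditModel) (j k : ℕ) (x : List Bool) :
    editBall m (j + k) x = (editBall m j x).flatMap (editBall m k) := by
  induction j generalizing x with
  | zero => simp [editBall]
  | succ j ih =>
    simp only [Nat.succ_add, editBall, List.flatMap_assoc]
    rw [show editBall m (j + k) = _ from funext ih]

theorem length_flatMap_le {α β : Type} {l : List α} {f : α → List β} {M : ℕ}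
    (h : ∀ a ∈ l, (f a).length ≤ M) : (l.flatMap f).length ≤ l.length * M := by
  induction l with
  | nil => simp
  | cons a l ih =>
    have h₁ := h a List.mem_cons_self
    have h₂ := ih fun b hb => h b (List.mem_cons_of_mem _ hb)
    simp only [List.flatMap_cons, List.length_append, List.length_cons, add_mul, one_mul]
    omega

theorem length_neighbors_le (m : EditModel) (x : List Bool) :
    (neighbors m x).length ≤ (x.length + 1) * 6 := by
  have : (neighbors m x).length ≤ _ := length_flatMap_le (l := List.range (x.length + 1))
    (f := fun i => editsAt m (x.take i) (x.drop i)) (M := 6)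
    fun i _ => by cases m <;> simp [editsAt]
  simpa only [List.length_range] using this

theorem EditStep.length_le {m : EditModel} {x y : List Bool} (h : EditStep m x y) :
    y.length ≤ x.length + 1 := by
  cases h <;> simp <;> omega

theorem EditsWithin.length_le {m : EditModel} {k : ℕ} {x y : List Bool}
    (h : EditsWithin m k x y) : y.length ≤ x.length + k := by
  induction h with
  | refl k x => omega
  | step h₁ _ ih =>
    have := h₁.length_le
    omega

theorem length_editBall_le (m : EditModel) (k L : ℕ) (x : List Bool) (hx : x.length + k ≤ L) :
    (editBall m k x).length ≤ ((L + 1) * 6) ^ k := by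
  induction k generalizing x with
  | zero => simp [editBall]
  | succ k ih =>
    have h₁ := length_flatMap_le (l := neighbors m x) (f := editBall m k)
      (M := ((L + 1) * 6) ^ k) fun y hy => ih y <| by
        rcases eq_or_editStep_of_mem_neighbors hy with rfl | h
        · omega
        · have := h.length_le
          omega
    have h₂ := length_neighbors_le m x
    rw [pow_succ']
    refine h₁.trans (Nat.mul_le_mul_right _ (h₂.trans (Nat.mul_le_mul_right _ ?_)))
    omega

/-- If `Φ` corrects `a` edits, then few strings within `k + a` edits of `x` have the same length and
the same syndrome as `x`. -/
theorem CorrectsEdits.card_le {m : EditModel} {a : ℕ} {Φ : List Bool → List Bool}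
    (hΦ : CorrectsEdits m a Φ) (k : ℕ) (x : List Bool) (S : Finset (List Bool))
    (hS : ∀ y ∈ S, y ∈ editBall m (k + a) x ∧ y.length = x.length ∧ Φ y = Φ x) :
    S.card ≤ ((x.length + k + 1) * 6) ^ k := by
  -- Cut the path from `x` to `y` after `k` edits. Two strings of `S` with the same midpoint `z`
  -- would contradict `hΦ`, so `y ↦ z` is injective into the `k`-ball.
  have h : ∀ y ∈ S, ∃ z ∈ editBall m k x, y ∈ editBall m a z := fun y hy => by
    simpa only [editBall_add, List.mem_flatMap] using (hS y hy).1
  choose! z hz hz' using h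
  refine le_trans ?_ ((List.toFinset_card_le _).trans (length_editBall_le m k _ x le_rfl))
  refine Finset.card_le_card_of_injOn z (fun y hy => List.mem_toFinset.2 (hz y hy)) ?_
  intro y hy y' hy' hzz
  by_contra hne
  refine hΦ y y' (z y) ((hS y hy).2.1.trans (hS y' hy').2.1.symm) hne
    (mem_editBall.1 (hz' y hy)).symm ?_ ((hS y hy).2.2.trans (hS y' hy').2.2.symm)
  rw [hzz]
  exact (mem_editBall.1 (hz' y' hy')).symm

/-! ### Separation by residues. -/

/-- Few nonzero numbers with few digits have a small common nondivisor. -/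
theorem exists_not_dvd {S : Finset ℕ} {N R : ℕ} (hN : S.card ≤ N) (h₀ : ∀ d ∈ S, d ≠ 0)
    (hR : ∀ d ∈ S, d ≤ 2 ^ R) : ∃ q < 2 * (R * N + 1), ∀ d ∈ S, ¬ (q + 1) ∣ d := by
  by_contra! hcon
  set n := R * N + 1 with hn
  have hprod : ∏ d ∈ S, d ≠ 0 := Finset.prod_ne_zero_iff.2 h₀
  -- Every prime power dividing the central binomial coefficient is at most `2 * n`, so by `hcon` it
  -- divides some member of `S`.
  have hdvd : n.centralBinom ∣ ∏ d ∈ S, d := by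
    refine (Nat.dvd_iff_prime_pow_dvd_dvd _ _).2 fun p k hp hk => ?_
    rcases Nat.eq_zero_or_pos k with rfl | hk₀
    · simp
    have hle : p ^ k ≤ 2 * n := by
      refine le_trans (Nat.pow_le_pow_right hp.pos ?_)
        (Nat.pow_factorization_choose_le (p := p) (n := 2 * n) (k := n) (by omega))
      exact (hp.pow_dvd_iff_le_factorization (Nat.centralBinom_ne_zero n)).1 hk
    have hpos := Nat.pow_pos (n := k) hp.pos
    obtain ⟨d, hd, hd'⟩ := hcon (p ^ k - 1) (by omega)
    rw [Nat.sub_add_cancel hpos] at hd'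
    exact hd'.trans (Finset.dvd_prod_of_mem _ hd)
  have h₁ : n.centralBinom ≤ 2 ^ (R * N) := by
    refine (Nat.le_of_dvd (Nat.pos_of_ne_zero hprod) hdvd).trans ?_
    refine (Finset.prod_le_pow_card _ _ _ hR).trans ?_
    rw [← pow_mul]
    exact Nat.pow_le_pow_right two_pos (Nat.mul_le_mul_left _ hN)
  -- With `n = R * N + 1` the left side is `4 * 4 ^ (R * N)`, but the right side is at most `2 * 4 ^
  -- (R * N)`.
  have h₂ := Nat.four_pow_le_two_mul_self_mul_centralBinom n (by omega)
  have h₃ : n ≤ 2 ^ (R * N) := Nat.lt_two_pow_self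
  have h₄ : (4 : ℕ) ^ n = 4 * (2 ^ (R * N) * 2 ^ (R * N)) := by
    rw [hn, pow_succ', ← mul_pow]; norm_num
  have h₅ := Nat.mul_le_mul h₃ h₁
  have h₆ : 0 < 2 ^ (R * N) * 2 ^ (R * N) := by positivity
  rw [mul_assoc] at h₂
  omega

/-- The least seed up to `B` such that the residues of `v` tell `x` from all strings in `L`. -/
def seed (v : List Bool → ℕ) (L : List (List Bool)) (B : ℕ) (x : List Bool) : ℕ :=
  search (fun q => L.all fun y => !(v y % (q + 1) == v x % (q + 1))) B

theorem seed_spec {v : List Bool → ℕ} {L : List (List Bool)} {N R B : ℕ} {x : List Bool}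
    (hv : ∀ y ∈ L, v y ≠ v x) (hR : ∀ y ∈ L, v y ≤ 2 ^ R) (hx : v x ≤ 2 ^ R)
    (hN : L.toFinset.card ≤ N) (hB : 2 * (R * N + 1) ≤ B) {y : List Bool} (hy : y ∈ L) :
    v y % (seed v L B x + 1) ≠ v x % (seed v L B x + 1) := by
  have := search_spec (good := fun q => L.all fun y => !(v y % (q + 1) == v x % (q + 1)))
    (B := B) ?_
  · simpa [seed] using List.all_eq_true.1 this y hy
  obtain ⟨q, hq, h⟩ := exists_not_dvd
    -- With truncated subtraction, this sum is the absolute difference; a modulus separates the two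
    -- values exactly when it does not divide it.
    (S := L.toFinset.image fun y => (v y - v x) + (v x - v y)) (N := N) (R := R)
    (Finset.card_image_le.trans hN)
    (by
      simp only [Finset.mem_image, List.mem_toFinset, forall_exists_index, and_imp]
      rintro _ y hy rfl
      have := hv y hy
      omega)
    (by
      simp only [Finset.mem_image, List.mem_toFinset, forall_exists_index, and_imp]
      rintro _ y hy rfl
      have := hR y hy
      omega)
  refine ⟨q, by omega, List.all_eq_true.2 fun y hy => ?_⟩
  have h₁ := h _ (Finset.mem_image_of_mem _ (List.mem_toFinset.2 hy))
  simp only [Bool.not_eq_true', beq_eq_false_iff_ne]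
  intro h₂
  apply h₁
  rcases le_total (v x) (v y) with h₃ | h₃
  · rw [Nat.sub_eq_zero_of_le h₃, add_zero]
    exact (Nat.modEq_iff_dvd' h₃).1 (Eq.symm h₂)
  · rw [Nat.sub_eq_zero_of_le h₃, zero_add]
    exact (Nat.modEq_iff_dvd' h₃).1 h₂

/-! ### Passage between `PolyTime` and the notions of the statement. -/

/-- Unlike size, height is not inflated by sharing. It bounds the length of a coded string, so
`polyTime_of_computable` can recover the size bound missing from `ComputableInPolyTime`. -/
theorem Run.height_le {P : Prog} {v w : Val} {t : ℕ} (h : Run P v w t) :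
    w.height ≤ v.height + t := by
  induction h <;> (try simp only [Val.height] at *) <;> omega

theorem length_le_height (x : List Bool) : x.length ≤ (encodeString x).height := by
  induction x with
  | nil => simp
  | cons c x ih => simp only [encodeString, Val.height, List.length_cons]; omega

theorem height_lt_size (v : Val) : v.height < v.size := by
  induction v with
  | nil => simp [Val.height, Val.size]
  | cons u v hu hv => simp only [Val.height, Val.size]; omega

theorem polyTime_of_computable {f : List Bool → List Bool} (hf : ComputableInPolyTime f) :
    PolyTime f := by
  obtain ⟨P, p, h⟩ := hf
  refine PolyTime.of_bounds P (4 * (.X + p) + 1) p (fun x => ?_) fun x => ?_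
  · obtain ⟨t, ht, hr⟩ := h x
    have h₁ := sz_string_le (f x)
    have h₂ := length_le_height (f x)
    have h₃ := hr.height_le
    have h₄ : _ < sz x := height_lt_size (enc x)
    rw [enc_string] at h₄
    have h₅ := p.eval_mono_nat (length_lt_sz x).le
    simp only [Polynomial.eval_add, Polynomial.eval_mul, Polynomial.eval_ofNat, Polynomial.eval_X,
      Polynomial.eval_one]
    omega
  · obtain ⟨t, ht, hr⟩ := h x
    rw [enc_string, enc_string]
    exact ⟨t, ht.trans (p.eval_mono_nat (length_lt_sz x).le), hr⟩

theorem PolyTime.computable {f : List Bool → List Bool} (hf : PolyTime f) :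
    ComputableInPolyTime f := by
  obtain ⟨P, p, h⟩ := hf
  refine ⟨P, p.comp (4 * .X + 1), fun x => ?_⟩
  obtain ⟨t, ht, hr⟩ := (h x).2
  rw [enc_string, enc_string] at hr
  refine ⟨t, ht.trans ?_, hr⟩
  rw [Polynomial.eval_comp]
  apply p.eval_mono_nat
  simpa using sz_string_le x

/-- Time must be polynomial in the block length rather than in the input size; this suffices because
`y` is at most `b` longer than `x` and both syndromes have polynomial size. -/
theorem PolyTime.decodes {m : EditModel} {b : ℕ} {Φ Ψ : List Bool → List Bool}
    {dec : ℕ → List Bool → List Bool → List Bool → List Bool} (hΦ : PolyTime Φ) (hΨ : PolyTime Ψ)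
    (hd : PolyTime fun d : ℕ × List Bool × List Bool × List Bool =>
      dec d.1 d.2.1 d.2.2.1 d.2.2.2) : DecodesInPolyTime m b Φ Ψ dec := by
  obtain ⟨P, p, h⟩ := hd
  obtain ⟨q, hq⟩ := hΦ.size_le
  obtain ⟨r, hr⟩ := hΨ.size_le
  refine ⟨P, p.comp (6 * .X + (.C (4 * b) + (q.comp (4 * .X + 1) + (r.comp (4 * .X + 1) + 5)))),
    fun x y hxy => ?_⟩
  obtain ⟨t, ht, hrun⟩ := (h (x.length, y, Φ x, Ψ x)).2
  simp only [enc_pair, enc_string] at hrun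
  refine ⟨t, ht.trans ?_, hrun⟩
  rw [Polynomial.eval_comp]
  apply p.eval_mono_nat
  have h₁ := hxy.length_le
  have h₂ := sz_string_le y
  have h₃ := (hq x).trans (q.eval_mono_nat (sz_string_le x))
  have h₄ := (hr x).trans (r.eval_mono_nat (sz_string_le x))
  simp only [sz_pair, sz_nat, Polynomial.eval_add, Polynomial.eval_mul, Polynomial.eval_comp,
    Polynomial.eval_ofNat, Polynomial.eval_X, Polynomial.eval_one, Polynomial.eval_C]
  omega

/-! ### The two-stage construction and its correctness. -/

/-- A bound for the number of strings within `k` edits of a string of length `n`. -/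
def ballBound (k n : ℕ) : ℕ := ((n + k + 1) * 6) ^ k

/-- The strings of the same length as `x` that may be confused with `x` after `b` edits. -/
def confusable (m : EditModel) (b : ℕ) (x : List Bool) : List (List Bool) :=
  (editBall m (b + b) x).filter fun y => y.length == x.length && !(y == x)

/-- A bound for the seeds that separate strings of length `n`. -/
def seedBound (b n : ℕ) : ℕ := 2 * (n * ballBound (b + b) n + 1)

/-- A seed that separates `x` from all strings that may be confused with it. -/
def stringSeed (m : EditModel) (b : ℕ) (x : List Bool) : ℕ :=
  seed binVal (confusable m b x) (seedBound b x.length) x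

/-- A number of polynomial size that separates `x` from all strings that may be confused with it. -/
def digest (m : EditModel) (b : ℕ) (x : List Bool) : ℕ :=
  stringSeed m b x * (seedBound b x.length + 1) + binVal x % (stringSeed m b x + 1)

/-- A bound for the number of binary digits of the digests of strings of length `n`. -/
def digestLength (b n : ℕ) : ℕ := Nat.log 2 ((seedBound b n + 1) ^ 2) + 1

/-- A bound for the seeds that separate the digests of strings of length `n` with the same
`a`-edit-correcting syndrome. -/
def digestSeedBound (a b n : ℕ) : ℕ := 2 * (digestLength b n * ballBound (b + b - a) n + 1)

/-- A seed that separates the digest of `x` from those of the strings with the same syndrome that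
may be confused with `x`. -/
def digestSeed (m : EditModel) (a b : ℕ) (Φ : List Bool → List Bool) (x : List Bool) : ℕ :=
  seed (digest m b) ((confusable m b x).filter fun y => Φ y == Φ x)
    (digestSeedBound a b x.length) x

/-- The number of bits used for a digest seed, and for a residue. -/
def width (a b n : ℕ) : ℕ := Nat.log 2 (digestSeedBound a b n) + 1

/-- The additional syndrome that upgrades the syndrome `Φ` from `a` edits to `b` edits. -/
def upgrade (m : EditModel) (a b : ℕ) (Φ : List Bool → List Bool) (x : List Bool) : List Bool :=
  bits (width a b x.length) (digestSeed m a b Φ x) ++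
    bits (width a b x.length) (digest m b x % (digestSeed m a b Φ x + 1))

/-- The decoder looks for a string close to `y` that has the given syndromes. -/
def decoder (m : EditModel) (b : ℕ) (Φ Ψ : List Bool → List Bool) (n : ℕ) (y s t : List Bool) :
    List Bool :=
  ((editBall m b y).filter fun x => x.length == n && (Φ x == s && Ψ x == t)).headD []

theorem length_upgrade (m : EditModel) (a b : ℕ) (Φ : List Bool → List Bool) (x : List Bool) :
    (upgrade m a b Φ x).length = 2 * width a b x.length := by
  simp [upgrade, two_mul]

theorem mem_confusable {m : EditModel} {b : ℕ} {x y : List Bool} :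
    y ∈ confusable m b x ↔ y ∈ editBall m (b + b) x ∧ y.length = x.length ∧ y ≠ x := by
  simp [confusable]

theorem stringSeed_le (m : EditModel) (b : ℕ) (x : List Bool) :
    stringSeed m b x ≤ seedBound b x.length := search_le _ _

theorem digest_lt (m : EditModel) (b : ℕ) (x : List Bool) :
    digest m b x < (seedBound b x.length + 1) ^ 2 := by
  have h₁ := stringSeed_le m b x
  have h₂ : binVal x % (stringSeed m b x + 1) < stringSeed m b x + 1 :=
    Nat.mod_lt _ (Nat.succ_pos _)
  have h₃ := Nat.mul_le_mul_right (seedBound b x.length + 1) h₁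
  unfold digest
  rw [sq, add_mul _ _ (seedBound b x.length + 1), one_mul]
  omega

/-- Seed and residue are the two digits of the digest in base `seedBound + 1`. Equal digests thus
give equal seeds and equal residues for that one modulus, which the choice of the seed of `x`
excludes. -/
theorem digest_ne {m : EditModel} {b : ℕ} {x y : List Bool} (hy : y ∈ confusable m b x) :
    digest m b y ≠ digest m b x := by
  intro h
  have hy' := mem_confusable.1 hy
  have h₁ := stringSeed_le m b x
  have h₂ : binVal x % (stringSeed m b x + 1) < stringSeed m b x + 1 :=
    Nat.mod_lt _ (Nat.succ_pos _)
  have h₃ := stringSeed_le m b y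
  have h₄ : binVal y % (stringSeed m b y + 1) < stringSeed m b y + 1 :=
    Nat.mod_lt _ (Nat.succ_pos _)
  rw [hy'.2.1] at h₃
  have hx : binVal x % (stringSeed m b x + 1) < seedBound b x.length + 1 := by omega
  have hz : binVal y % (stringSeed m b y + 1) < seedBound b x.length + 1 := by omega
  have hm := congrArg (· % (seedBound b x.length + 1)) h
  simp only [digest, hy'.2.1] at h hm
  rw [Nat.mul_add_mod', Nat.mul_add_mod', Nat.mod_eq_of_lt hx, Nat.mod_eq_of_lt hz] at hm
  rw [hm, Nat.add_right_cancel_iff] at h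
  rw [Nat.eq_of_mul_eq_mul_right (Nat.succ_pos _) h] at hm
  refine seed_spec (N := ballBound (b + b) x.length) (R := x.length) ?_ ?_ (binVal_lt x).le ?_
    le_rfl hy hm
  · intro z hz hzx
    have := mem_confusable.1 hz
    exact this.2.2 (binVal_injective this.2.1 hzx)
  · intro z hz
    rw [← (mem_confusable.1 hz).2.1]
    exact (binVal_lt z).le
  · refine (List.toFinset_card_le _).trans ((List.length_filter_le _ _).trans ?_)
    exact length_editBall_le _ _ _ _ le_rfl

/-- The second round of hashing: `R` is now the length of a digest, and `CorrectsEdits.card_le` with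
`k = 2b - a` bounds the number of competitors. -/
theorem digest_mod_ne {m : EditModel} {a b : ℕ} (hab : a < b) {Φ : List Bool → List Bool}
    (hΦ : CorrectsEdits m a Φ) {x y : List Bool} (hy : y ∈ confusable m b x) (h : Φ y = Φ x) :
    digest m b y % (digestSeed m a b Φ x + 1) ≠ digest m b x % (digestSeed m a b Φ x + 1) := by
  have hle (z : List Bool) (hz : z.length = x.length) :
      digest m b z ≤ 2 ^ digestLength b x.length := by
    rw [← hz]
    exact (digest_lt m b z).le.trans (Nat.lt_pow_succ_log_self one_lt_two _).le
  refine seed_spec (N := ballBound (b + b - a) x.length) (R := digestLength b x.length)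
    ?_ ?_ (hle x rfl) ?_ le_rfl (List.mem_filter.2 ⟨hy, by simpa using h⟩)
  · intro z hz
    exact digest_ne (List.mem_filter.1 hz).1
  · intro z hz
    exact hle z (mem_confusable.1 (List.mem_filter.1 hz).1).2.1
  · refine hΦ.card_le _ _ _ fun z hz => ?_
    rw [List.mem_toFinset, List.mem_filter, mem_confusable] at hz
    refine ⟨?_, hz.1.2.1, by simpa using hz.2⟩
    rw [Nat.sub_add_cancel (by omega)]
    exact hz.1.1

theorem eq_of_upgrade_eq {m : EditModel} {a b : ℕ} (hab : a < b) {Φ : List Bool → List Bool}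
    (hΦ : CorrectsEdits m a Φ) {x y : List Bool} (hy : y ∈ editBall m (b + b) x)
    (hl : y.length = x.length) (h : Φ y = Φ x) (h' : upgrade m a b Φ y = upgrade m a b Φ x) :
    y = x := by
  by_contra hne
  have hc : y ∈ confusable m b x := mem_confusable.2 ⟨hy, hl, hne⟩
  have hlt (z : List Bool) (hz : z.length = x.length) :
      digestSeed m a b Φ z < 2 ^ width a b x.length := by
    rw [← hz]
    exact (search_le _ _).trans_lt (Nat.lt_pow_succ_log_self one_lt_two _)
  -- A residue is at most its seed, so one width serves both blocks.
  have hlt' (z : List Bool) (hz : z.length = x.length) :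
      digest m b z % (digestSeed m a b Φ z + 1) < 2 ^ width a b x.length :=
    (Nat.le_of_lt_succ (Nat.mod_lt _ (Nat.succ_pos _))).trans_lt (hlt z hz)
  unfold upgrade at h'
  rw [hl] at h'
  obtain ⟨h₁, h₂⟩ := List.append_inj h' (by simp)
  have h₃ := bits_injective (hlt y hl) (hlt x rfl) h₁
  have h₄ := bits_injective (hlt' y hl) (hlt' x rfl) h₂
  rw [h₃] at h₄
  exact digest_mod_ne hab hΦ hc h h₄

/-- Every candidate is within `2b` edits of `x` by way of `y`, so `eq_of_upgrade_eq` leaves only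
`x`; the default `[]` is never returned. -/
theorem recovers_decoder {m : EditModel} {a b : ℕ} (hab : a < b) {Φ : List Bool → List Bool}
    (hΦ : CorrectsEdits m a Φ) :
    Recovers m b Φ (upgrade m a b Φ) (decoder m b Φ (upgrade m a b Φ)) := by
  intro x y hxy
  set L := (editBall m b y).filter fun z =>
    z.length == x.length && (Φ z == Φ x && upgrade m a b Φ z == upgrade m a b Φ x) with hL
  have hx : x ∈ L := by simpa [hL] using mem_editBall.2 hxy.symm
  have huniq : ∀ z ∈ L, z = x := by
    intro z hz
    simp only [hL, List.mem_filter, Bool.and_eq_true, beq_iff_eq] at hz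
    refine eq_of_upgrade_eq hab hΦ ?_ hz.2.1 hz.2.2.1 hz.2.2.2
    rw [editBall_add, List.mem_flatMap]
    exact ⟨y, mem_editBall.2 hxy, hz.1⟩
  change L.headD [] = x
  cases h : L with
  | nil => simp [h] at hx
  | cons z l => exact huniq z (by simp [h])

/-! ### Polynomial running time of the construction. -/

namespace PolyTime

variable {γ : Type} [Enc γ]

-- The radius is a constant, so the induction on `k` builds a separate program and polynomial for
-- each radius.
@[fun_prop] theorem editBall (m : EditModel) (k : ℕ) {f : γ → List Bool} (hf : PolyTime f) :
    PolyTime (fun c => editBall m k (f c)) := by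
  have h₁ : PolyTime fun p : List Bool × ℕ => editsAt m (p.1.take p.2) (p.1.drop p.2) := by
    cases m
    · simp only [editsAt]; fun_prop
    · simp only [editsAt]; fun_prop
  have h₂ : PolyTime (neighbors m) :=
    flatMap (f := fun (x : List Bool) i => editsAt m (x.take i) (x.drop i)) h₁ (by fun_prop)
  have h₃ : PolyTime (_root_.editBall m k) := by
    induction k with
    | zero => simp only [_root_.editBall]; fun_prop
    | succ k ih => exact flatMap (f := fun _ y => _root_.editBall m k y) (ih.comp snd) h₂
  exact h₃.comp hf

@[fun_prop] theorem ballBound (k : ℕ) {f : γ → ℕ} (hf : PolyTime f) :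
    PolyTime (fun c => ballBound k (f c)) := by
  unfold _root_.ballBound; fun_prop

@[fun_prop] theorem seedBound (b : ℕ) {f : γ → ℕ} (hf : PolyTime f) :
    PolyTime (fun c => seedBound b (f c)) := by
  unfold _root_.seedBound; fun_prop

@[fun_prop] theorem digestSeedBound (a b : ℕ) {f : γ → ℕ} (hf : PolyTime f) :
    PolyTime (fun c => digestSeedBound a b (f c)) := by
  unfold _root_.digestSeedBound digestLength; fun_prop

@[fun_prop] theorem width (a b : ℕ) {f : γ → ℕ} (hf : PolyTime f) :
    PolyTime (fun c => width a b (f c)) := by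
  unfold _root_.width; fun_prop

@[fun_prop] theorem confusable (m : EditModel) (b : ℕ) {f : γ → List Bool} (hf : PolyTime f) :
    PolyTime (fun c => confusable m b (f c)) :=
  filter (l := fun c => _root_.editBall m (b + b) (f c))
    (f := fun c y => y.length == (f c).length && !(y == f c)) (by fun_prop) (by fun_prop)

/-- Only the residues of `v` are assumed computable, because for `v = binVal` the value itself is
too long in unary. -/
theorem seed {v : List Bool → ℕ} {L : γ → List (List Bool)} {B : γ → ℕ} {f : γ → List Bool}
    (hv : PolyTime fun p : List Bool × ℕ => v p.1 % (p.2 + 1)) (hL : PolyTime L) (hB : PolyTime B)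
    (hf : PolyTime f) : PolyTime (fun c => seed v (L c) (B c) (f c)) := by
  refine search (all (l := fun p : γ × ℕ => L p.1)
    (f := fun p y => !(v y % (p.2 + 1) == v (f p.1) % (p.2 + 1))) ?_ (by fun_prop)) hB
  have h₁ := hv.comp (by fun_prop : PolyTime fun p : (γ × ℕ) × List Bool => (p.2, p.1.2))
  have h₂ := hv.comp (by fun_prop : PolyTime fun p : (γ × ℕ) × List Bool => (f p.1.1, p.1.2))
  fun_prop

@[fun_prop] theorem stringSeed (m : EditModel) (b : ℕ) {f : γ → List Bool} (hf : PolyTime f) :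
    PolyTime (fun c => stringSeed m b (f c)) :=
  seed (by fun_prop) (by fun_prop) (by fun_prop) hf

@[fun_prop] theorem digest (m : EditModel) (b : ℕ) {f : γ → List Bool} (hf : PolyTime f) :
    PolyTime (fun c => digest m b (f c)) := by
  unfold _root_.digest; fun_prop

theorem digestSeed (m : EditModel) (a b : ℕ) {Φ : List Bool → List Bool} (hΦ : PolyTime Φ) :
    PolyTime (digestSeed m a b Φ) := by
  refine seed (by fun_prop) (filter (f := fun x y => Φ y == Φ x) ?_ (by fun_prop)) (by fun_prop)
    id'
  fun_prop

theorem upgrade (m : EditModel) (a b : ℕ) {Φ : List Bool → List Bool} (hΦ : PolyTime Φ) :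
    PolyTime (upgrade m a b Φ) := by
  have := digestSeed m a b hΦ
  unfold _root_.upgrade
  fun_prop

theorem decoder (m : EditModel) (b : ℕ) {Φ Ψ : List Bool → List Bool} (hΦ : PolyTime Φ)
    (hΨ : PolyTime Ψ) : PolyTime fun d : ℕ × List Bool × List Bool × List Bool =>
      decoder m b Φ Ψ d.1 d.2.1 d.2.2.1 d.2.2.2 := by
  have := filter (l := fun d : ℕ × List Bool × List Bool × List Bool =>
      _root_.editBall m b d.2.1) (f := fun d x => x.length == d.1 &&
      (Φ x == d.2.2.1 && Ψ x == d.2.2.2)) (by fun_prop) (by fun_prop)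
  unfold _root_.decoder
  fun_prop

end PolyTime

/-! ### Length of the additional syndrome. -/

/-- A function that grows at most polynomially. -/
def PolyGrowth (f : ℕ → ℕ) : Prop := ∃ E : ℕ, ∀ n, 2 ≤ n → f n ≤ n ^ E

namespace PolyGrowth

variable {f g : ℕ → ℕ}

theorem const (c : ℕ) : PolyGrowth fun _ => c :=
  ⟨c, fun _ hn => Nat.lt_two_pow_self.le.trans (Nat.pow_le_pow_left hn c)⟩

theorem id' : PolyGrowth fun n => n := ⟨1, fun n _ => by simp⟩

theorem mul (hf : PolyGrowth f) (hg : PolyGrowth g) : PolyGrowth fun n => f n * g n := by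
  obtain ⟨E, hE⟩ := hf
  obtain ⟨F, hF⟩ := hg
  exact ⟨E + F, fun n hn => by rw [pow_add]; exact Nat.mul_le_mul (hE n hn) (hF n hn)⟩

theorem add (hf : PolyGrowth f) (hg : PolyGrowth g) : PolyGrowth fun n => f n + g n := by
  obtain ⟨E, hE⟩ := hf
  obtain ⟨F, hF⟩ := hg
  refine ⟨E + F + 1, fun n hn => ?_⟩
  have h₁ := (hE n hn).trans (Nat.pow_le_pow_right (by omega) (Nat.le_add_right E F))
  have h₂ := (hF n hn).trans (Nat.pow_le_pow_right (by omega) (Nat.le_add_left F E))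
  have h₃ := Nat.mul_le_mul_left (n ^ (E + F)) hn
  rw [pow_succ]
  dsimp only
  omega

theorem pow (hf : PolyGrowth f) (k : ℕ) : PolyGrowth fun n => f n ^ k := by
  obtain ⟨E, hE⟩ := hf
  exact ⟨E * k, fun n hn => by rw [pow_mul]; exact Nat.pow_le_pow_left (hE n hn) k⟩

end PolyGrowth

theorem polyGrowth_seedBound (b : ℕ) : PolyGrowth (seedBound b) :=
  (PolyGrowth.const 2).mul ((PolyGrowth.id'.mul ((((PolyGrowth.id'.add (.const (b + b))).add
    (.const 1)).mul (.const 6)).pow (b + b))).add (.const 1))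

/-- Digests have O(log n) bits, so their length enters the logarithm of the modulus bound only as
log log n. -/
theorem exists_width_le (a b : ℕ) : ∃ K : ℝ, 0 ≤ K ∧ ∀ n : ℕ, 3 ≤ n →
    (width a b n : ℝ) ≤ ((b + b - a : ℕ) : ℝ) * Real.logb 2 n +
      Real.logb 2 (Real.logb 2 n) + K := by
  obtain ⟨E, hE⟩ := ((polyGrowth_seedBound b).add (.const 1)).pow 2
  set k := b + b - a with hk
  -- Chosen so that `(n + k + 1) * 6 ≤ c * n` for `n ≥ 1`.
  set c : ℝ := (k + 2) * 6 with hc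
  have hc₁ : 1 ≤ c := by
    have : (0 : ℝ) ≤ k := by positivity
    rw [hc]; linarith
  have hlogc : 0 ≤ Real.logb 2 c := Real.logb_nonneg one_lt_two hc₁
  have hlogE : 0 ≤ Real.logb 2 ((E : ℝ) + 1) :=
    Real.logb_nonneg one_lt_two (by linarith [show (0 : ℝ) ≤ E by positivity])
  -- The 3 is log 4, from the factor 4 in `hB`, plus the 1 in `width`.
  refine ⟨3 + Real.logb 2 (E + 1) + k * Real.logb 2 c, by positivity, fun n hn => ?_⟩
  have hn' : (3 : ℝ) ≤ n := by exact_mod_cast hn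
  have hlog : 1 ≤ Real.logb 2 (n : ℝ) := by
    rw [Real.le_logb_iff_rpow_le one_lt_two (by linarith)]
    norm_num; linarith
  have hR : (digestLength b n : ℝ) ≤ (E + 1) * Real.logb 2 n := by
    have h₁ : (Nat.log 2 ((seedBound b n + 1) ^ 2) : ℝ) ≤
        Real.logb 2 (((seedBound b n + 1) ^ 2 : ℕ) : ℝ) := by
      exact_mod_cast Real.natLog_le_logb _ 2
    have h₂ : Real.logb 2 (((seedBound b n + 1) ^ 2 : ℕ) : ℝ) ≤ Real.logb 2 ((n : ℝ) ^ E) :=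
      Real.logb_le_logb_of_le one_lt_two (by positivity) (by exact_mod_cast hE n (by omega))
    rw [Real.logb_pow] at h₂
    unfold digestLength
    push_cast at *
    linarith
  have hR₁ : (1 : ℝ) ≤ digestLength b n := by
    exact_mod_cast Nat.succ_le_of_lt (Nat.succ_pos _)
  have hN : (ballBound k n : ℝ) ≤ (c * n) ^ k := by
    unfold ballBound
    push_cast
    refine pow_le_pow_left₀ (by positivity) ?_ k
    rw [hc]
    nlinarith [show (0 : ℝ) ≤ k by positivity]
  have hN₁ : (1 : ℝ) ≤ (c * n) ^ k := one_le_pow₀ (by nlinarith)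
  have hB : (digestSeedBound a b n : ℝ) ≤ 4 * ((E + 1) * Real.logb 2 n * (c * n) ^ k) := by
    have h₁ : (digestLength b n : ℝ) * ballBound k n ≤
        (E + 1) * Real.logb 2 n * (c * n) ^ k := by gcongr
    have h₂ : 1 ≤ (E + 1) * Real.logb 2 n * (c * n) ^ k :=
      one_le_mul_of_one_le_of_one_le (hR₁.trans hR) hN₁
    unfold digestSeedBound
    rw [← hk]
    push_cast
    linarith
  have h₁ : (Nat.log 2 (digestSeedBound a b n) : ℝ) ≤ Real.logb 2 (digestSeedBound a b n) := by
    exact_mod_cast Real.natLog_le_logb _ 2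
  have h₂ := Real.logb_le_logb_of_le one_lt_two
    (by exact_mod_cast (show 0 < digestSeedBound a b n by unfold digestSeedBound; omega)) hB
  have h₄ : Real.logb 2 4 = 2 := by
    rw [show (4 : ℝ) = 2 ^ (2 : ℕ) by norm_num, Real.logb_pow, Real.logb_self_eq_one one_lt_two]
    norm_num
  rw [Real.logb_mul (by norm_num) (by positivity), Real.logb_mul (by positivity) (by positivity),
    Real.logb_mul (by positivity) (by positivity), Real.logb_pow,
    Real.logb_mul (by positivity) (by positivity), h₄] at h₂
  unfold width
  push_cast
  linarith

theorem theorem4 (m : EditModel) (a b : ℕ) (ha : 0 < a) (hab : a < b) :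
    ∃ (ρ : ℕ → ℕ) (C : ℝ),
      (∀ n : ℕ, 3 ≤ n →
        (ρ n : ℝ) ≤ (4 * (b : ℝ) - 2 * (a : ℝ)) * Real.logb 2 (n : ℝ)
          + C * Real.logb 2 (Real.logb 2 (n : ℝ))) ∧
      ∀ Φa : List Bool → List Bool, CorrectsEdits m a Φa →
        ∃ (Φba : List Bool → List Bool)
          (dec : ℕ → List Bool → List Bool → List Bool → List Bool),
          (∀ x : List Bool, (Φba x).length = ρ x.length) ∧
          Recovers m b Φa Φba dec ∧
          (ComputableInPolyTime Φa →
            ComputableInPolyTime Φba ∧ DecodesInPolyTime m b Φa Φba dec) := by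
  obtain ⟨K, hK, hw⟩ := exists_width_le a b
  have hlog : 1 < Real.logb 2 3 := by
    rw [Real.lt_logb_iff_rpow_lt one_lt_two (by norm_num)]
    norm_num
  -- The least value of log log n for `n ≥ 3`. It is positive, so the additive constant `2 * K` is
  -- at most `2 * K / l` times log log n.
  set l := Real.logb 2 (Real.logb 2 3) with hl
  have hl₀ : 0 < l := Real.logb_pos one_lt_two hlog
  refine ⟨fun n => 2 * width a b n, 2 + 2 * K / l, fun n hn => ?_, fun Φ hΦ =>
    ⟨upgrade m a b Φ, decoder m b Φ (upgrade m a b Φ), length_upgrade m a b Φ,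
      recovers_decoder hab hΦ, fun h => ?_⟩⟩
  · have hn' : (3 : ℝ) ≤ n := by exact_mod_cast hn
    have h₁ : l ≤ Real.logb 2 (Real.logb 2 n) :=
      Real.logb_le_logb_of_le one_lt_two (by linarith)
        (Real.logb_le_logb_of_le one_lt_two (by norm_num) hn')
    have h₂ : 2 * K ≤ 2 * K / l * Real.logb 2 (Real.logb 2 n) := by
      rw [div_mul_eq_mul_div, le_div_iff₀ hl₀]
      gcongr
    have h₃ := hw n hn
    rw [Nat.cast_sub (by omega)] at h₃
    push_cast at *
    linarith
  · have hΦ' := polyTime_of_computable h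
    have hΨ := PolyTime.upgrade m a b hΦ'
    exact ⟨hΨ.computable, hΦ'.decodes hΨ (PolyTime.decoder m b hΦ' hΨ)⟩
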